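/- **Theorem 3.1.** Let $E\subset[0,+\infty[$ be a locally finite set endowed with a weight function $\omega:E\to\,]0,+\infty[$, and let $\mathcal N(t)=\sum_{x\in E,\ x\le t}\omega(x)$. Let $\alpha\in\mathbb R$ and $c,\delta,\kappa>0$ be such that, as $t\to+\infty$, $$\mathcal N(t)=c\,t^{\alpha}e^{\delta t}\bigl(1+O(e^{-\kappa t})\bigr).$$ For a function $\psi:\mathbb N\to[1,+\infty[$ let $$\mathcal R_N^{\psi}=\sum_{x,y\in E,\ x,y\le N}\omega(x)\,\omega(y)\,\Delta_{\psi(N)(y-x)},\qquad \psi'(N)=\frac{\mathcal N(N)^2}{\psi(N)},$$ where $\Delta_z$ is the unit Dirac mass at $z$, and let $\kappa'=\min\{\kappa,\delta\}$. Then there is a constant $C>0$, depending only on $E,\omega,c,\alpha,\delta,\kappa$, such that for every $\psi:\mathbb N\to[1,+\infty[$, every $A\ge 1$ and every $C^1$ function $f:\mathbb R\to\mathbb R$ with support in $[-A,A]$, the following inequalities hold for all $N$ large enough (how large may depend on all the data, including $\psi$, $A$ and $f$). 1. If $\alpha=0$ and $\psi=1$, then $$\Bigl|\frac{\mathcal R_N^{\psi}(f)}{\psi'(N)}-\int_{\mathbb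 R}f(t)\,\frac{\delta}{2}e^{-\delta|t|}\,dt\Bigr|\le C A e^{\delta A}e^{-\frac{\kappa'}{12}N}\|f\|_\infty+C A e^{-\frac{\kappa'}{4}N}\|f'\|_\infty .$$ 2. If $\alpha\ne0$ and $\psi=1$, then $$\Bigl|\frac{\mathcal R_N^{\psi}(f)}{\psi'(N)}-\int_{\mathbb R}f(t)\,\frac{\delta}{2}e^{-\delta|t|}\,dt\Bigr|\le C\,\frac{A^2}{N}\bigl(\|f\|_\infty+\|f'\|_\infty\bigr).$$ 3. If $\alpha=0$, $\lim_{N\to+\infty}\psi(N)=+\infty$ and $\psi$ grows subexponentially (that is, $\psi(N)e^{-\gamma N}\to0$ for every $\gamma>0$), then $$\Bigl|\frac{\mathcal R_N^{\psi}(f)}{\psi'(N)}-\frac{\delta}{2}\int_{\mathbb R}f(t)\,dt\Bigr|\le C\,\frac{A^2\|f\|_\infty}{\psi(N)}+C A^2e^{-\frac{\kappa'}{4}N}\psi(N)\|f'\|_\infty .$$ 4. If $\alpha\ne0$, $\lim_{N\to+\infty}\psi(N)=+\infty$ and $\psi$ grows at most polynomially (that is, $\psi(N)N^{-\gamma}\to0$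 for some $\gamma>0$), then $$\Bigl|\frac{\mathcal R_N^{\psi}(f)}{\psi'(N)}-\frac{\delta}{2}\int_{\mathbb R}f(t)\,dt\Bigr|\le C\,\frac{A^2}{\min\{N,\psi(N)\}}\bigl(\|f\|_\infty+\|f'\|_\infty\bigr).$$ -/

import Mathlib

open Filter MeasureTheory Set Topology Asymptotics

noncomputable section

namespace PairCorrelation

/-- A set of real numbers is locally finite if its points form a locally finite family, i.e. every
real number has a neighbourhood that contains only finitely many points of the set. -/
def IsLocallyFiniteSet (E : Set ℝ) : Prop :=
  LocallyFinite (fun x : E => ({(x : ℝ)} : Set ℝ))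

theorem IsLocallyFiniteSet.finite_le {E : Set ℝ} (hE : IsLocallyFiniteSet E)
    (hE0 : E ⊆ Ici 0) (t : ℝ) : {x ∈ E | x ≤ t}.Finite := by
  have h := hE.finite_nonempty_inter_compact (isCompact_Icc (a := (0 : ℝ)) (b := t))
  refine (h.image (fun x : E => (x : ℝ))).subset ?_
  rintro x ⟨hx, hxt⟩
  exact ⟨⟨x, hx⟩, ⟨x, rfl, hE0 hx, hxt⟩, rfl⟩

/-- The finite set `{x ∈ E : x ≤ t} = E ∩ [0, t]`, for `E ⊆ [0, +∞[` locally finite. -/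
def truncation (E : Set ℝ) (hE : IsLocallyFiniteSet E) (hE0 : E ⊆ Ici 0) (t : ℝ) : Finset ℝ :=
  (hE.finite_le hE0 t).toFinset

/-- The growth function `t ↦ ∑_{x ∈ E, x ≤ t} ω x`. -/
def growthFunction (E : Set ℝ) (hE : IsLocallyFiniteSet E) (hE0 : E ⊆ Ici 0) (ω : ℝ → ℝ)
    (t : ℝ) : ℝ :=
  ∑ x ∈ truncation E hE hE0 t, ω x

/-- The pair correlation measure at time `N` with scaling `ψ N` of a sequence `F` of finite sets of
real numbers with weights `ω`: the sum over `x, y ∈ F N` of `ω x * ω y` times the unit Dirac mass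
at `ψ N * (y - x)`. -/
def pairCorrelationMeasure (F : ℕ → Finset ℝ) (ω : ℝ → ℝ) (ψ : ℕ → ℝ) (N : ℕ) : Measure ℝ :=
  ∑ x ∈ F N, ∑ y ∈ F N, ENNReal.ofReal (ω x * ω y) • Measure.dirac (ψ N * (y - x))

/-- The renormalising function `ψ' N = (growth function at N)² / ψ N`. -/
def renormalisingFunction (E : Set ℝ) (hE : IsLocallyFiniteSet E) (hE0 : E ⊆ Ici 0) (ω : ℝ → ℝ)
    (ψ : ℕ → ℝ) (N : ℕ) : ℝ :=
  growthFunction E hE hE0 ω (N : ℝ) ^ 2 / ψ N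

/-- The renormalised pair correlation measure of the family `F_N = {x ∈ E : x ≤ N}`,
evaluated at the function `f`. -/
def renormalisedPairCorrelation (E : Set ℝ) (hE : IsLocallyFiniteSet E) (hE0 : E ⊆ Ici 0)
    (ω : ℝ → ℝ) (ψ : ℕ → ℝ) (f : ℝ → ℝ) (N : ℕ) : ℝ :=
  (∫ t, f t ∂(pairCorrelationMeasure (fun n : ℕ => truncation E hE hE0 (n : ℝ)) ω ψ N)) /
    renormalisingFunction E hE hE0 ω ψ N

/-- A positive sequence is subexponentially growing if it is `o(e^{γ n})` for every `γ > 0`. -/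
def SubexponentiallyGrowing (u : ℕ → ℝ) : Prop :=
  ∀ γ : ℝ, 0 < γ → Tendsto (fun n : ℕ => u n / Real.exp (γ * n)) atTop (𝓝 0)

/-- A positive sequence is at most polynomially growing if it is `o(n^γ)` for some `γ > 0`. -/
def AtMostPolynomiallyGrowing (u : ℕ → ℝ) : Prop :=
  ∃ γ : ℝ, 0 < γ ∧ Tendsto (fun n : ℕ => u n / (n : ℝ) ^ γ) atTop (𝓝 0)

/-- The function `g_δ : t ↦ (δ / 2) e^{-δ |t|}`. -/
def expDensity (δ t : ℝ) : ℝ := δ / 2 * Real.exp (-δ * |t|)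

/-- The supremum norm; used only for bounded functions. -/
def supNorm (f : ℝ → ℝ) : ℝ := ⨆ t : ℝ, |f t|

end PairCorrelation

end

open PairCorrelation

/-!
Put `Φ t = c * t ^ α * exp (δ * t)` and look at the points `x ≤ N` of `E` from the far end, through
the coordinate `u = N - x ≥ 0`, with weights divided by `Φ N`. The growth assumption says that the
tail `s ↦ ∑_{u ≥ s} ω / Φ N` is `Φ (N - s) / Φ N = exp (-δ * s) * (1 - s / N) ^ α` up to a uniform
error `O(exp (-min κ δ / 2 * N))`; to stay away from the singularity of `t ^ α` at `0` this is used
for `s ≤ N / 2` only, and everything beyond is exponentially small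
(`exists_abs_tail_sub_truncProfile_le`). Hence `u` is almost exponentially distributed with
parameter `δ`. The difference `y - x` of two points is the difference of their coordinates `u`, and
the difference of two independent exponential variables has the Laplace density `expDensity δ`
(`integral_integral_exp_sub`).

The scaling `ψ` is harmless because the two sources of error are measured differently
(`abs_sum_sub_integral_exp_le`). The exponentially small distance between the discrete tail and the
profile is paid, after a summation by parts, against the total variation `∫ |φ'|`, which is
invariant under rescaling. The profile itself differs from the exponential law by a density of sup
norm `O(1 / N)` (exponentially small if `α = 0`), and this is paid against `∫ |φ|`, which gains a
factor `1 / ψ N`. Replacing the two copies of the weighted set one after the other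
(`abs_sum_sum_sub_integral_expDensity_le`) and renormalising gives one estimate that is uniform in
`ψ`, `A` and `f`, with main term `∫ f t * expDensity δ (t / ψ N)`
(`exists_abs_renormalisedPairCorrelation_sub_le`). For `ψ = 1` this is the Laplace density; for
`ψ → ∞` the density flattens to the constant `δ / 2` on `[-A, A]` up to `O(A / ψ N)`
(`abs_integral_expDensity_div_sub_le`).
-/

noncomputable section

namespace PairCorrelation

/-! ### The profile of the growth function near its end point -/

theorem rpow_le_two_rpow_abs {b : ℝ} (hb : 1 / 2 ≤ b) (hb1 : b ≤ 1) (β : ℝ) :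
    b ^ β ≤ 2 ^ |β| := by
  have hb0 : 0 < b := by linarith
  calc b ^ β ≤ b ^ (-|β|) := Real.rpow_le_rpow_of_exponent_ge hb0 hb1 (neg_abs_le β)
    _ = (b⁻¹) ^ |β| := by rw [Real.rpow_neg hb0.le, Real.inv_rpow hb0.le]
    _ ≤ 2 ^ |β| := by
      apply Real.rpow_le_rpow (by positivity) _ (abs_nonneg β)
      rw [inv_le_comm₀ hb0 two_pos]; linarith

/-- A Lipschitz constant of `b ↦ b ^ α` on `[1/2, 1]`; it vanishes when `α = 0`. -/
def powLip (α : ℝ) : ℝ := |α| * 2 ^ |α - 1|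

theorem powLip_nonneg (α : ℝ) : 0 ≤ powLip α := by unfold powLip; positivity

theorem powLip_zero : powLip 0 = 0 := by simp [powLip]

theorem abs_mul_rpow_le_powLip {b : ℝ} (hb : 1 / 2 ≤ b) (hb1 : b ≤ 1) (α : ℝ) :
    |α * b ^ (α - 1)| ≤ powLip α := by
  have hb0 : 0 < b := by linarith
  rw [abs_mul, abs_of_nonneg (Real.rpow_nonneg hb0.le _)]
  exact mul_le_mul_of_nonneg_left (rpow_le_two_rpow_abs hb hb1 _) (abs_nonneg α)

theorem abs_rpow_sub_one_le {b : ℝ} (hb : 1 / 2 ≤ b) (hb1 : b ≤ 1) (α : ℝ) :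
    |b ^ α - 1| ≤ powLip α * (1 - b) := by
  have h := Convex.norm_image_sub_le_of_norm_hasDerivWithin_le (𝕜 := ℝ)
    (f := fun x : ℝ => x ^ α) (f' := fun x => α * x ^ (α - 1)) (s := Icc (1 / 2) 1)
    (x := 1) (y := b) (C := powLip α)
    (fun x hx => (Real.hasDerivAt_rpow_const
      (Or.inl (by have := hx.1; linarith : x ≠ 0))).hasDerivWithinAt)
    (fun x hx => abs_mul_rpow_le_powLip hx.1 hx.2 α) (convex_Icc _ _)
    (by norm_num) ⟨hb, hb1⟩
  simpa [Real.norm_eq_abs, abs_sub_comm b 1, abs_of_nonneg (sub_nonneg.2 hb1)] using h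

/-- The ratio `Φ (L - s) / Φ L` for `Φ t = t ^ α * exp (δ * t)`. -/
def profile (α δ L s : ℝ) : ℝ := Real.exp (-δ * s) * (1 - s / L) ^ α

/-- The derivative of `profile`. -/
def profileDeriv (α δ L s : ℝ) : ℝ :=
  -(Real.exp (-δ * s) * (δ * (1 - s / L) ^ α + α * (1 - s / L) ^ (α - 1) / L))

/-- The profile `s ↦ Φ (L - s) / Φ L`, continued by `1` to the left of `0` and cut off to the right
of `L / 2`. Cutting at `L / 2` keeps `1 - s / L` in `[1/2, 1]`, away from the singularity of
`t ^ α` at `t = 0`, and costs only an exponentially small error. -/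
def truncProfile (α δ L s : ℝ) : ℝ :=
  if s ≤ 0 then 1 else if s ≤ L / 2 then profile α δ L s else 0

theorem half_le_one_sub_div {L s : ℝ} (hL : 0 < L) (h : s ≤ L / 2) : 1 / 2 ≤ 1 - s / L := by
  have : s / L ≤ 1 / 2 := by rw [div_le_iff₀ hL]; linarith
  linarith

theorem one_sub_div_le_one {L s : ℝ} (hL : 0 < L) (h : 0 ≤ s) : 1 - s / L ≤ 1 := by
  have : 0 ≤ s / L := by positivity
  linarith

theorem profile_nonneg {α δ L s : ℝ} (hL : 0 < L) (h : s ≤ L / 2) : 0 ≤ profile α δ L s := by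
  have := half_le_one_sub_div hL h
  exact mul_nonneg (Real.exp_pos _).le (Real.rpow_nonneg (by linarith) _)

theorem profile_le {α δ L s : ℝ} (hL : 0 < L) (h0 : 0 ≤ s) (h : s ≤ L / 2) :
    profile α δ L s ≤ 2 ^ |α| * Real.exp (-δ * s) := by
  rw [mul_comm]
  exact mul_le_mul_of_nonneg_left
    (rpow_le_two_rpow_abs (half_le_one_sub_div hL h) (one_sub_div_le_one hL h0) α)
    (Real.exp_pos _).le

theorem hasDerivAt_profile {α δ L s : ℝ} (hL : 0 < L) (h : s ≤ L / 2) :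
    HasDerivAt (profile α δ L) (profileDeriv α δ L s) s := by
  have hb := half_le_one_sub_div hL h
  have h1 : HasDerivAt (fun s : ℝ => 1 - s / L) (-(1 / L)) s :=
    ((hasDerivAt_id s).div_const L).const_sub 1
  have h2 := h1.rpow_const (p := α) (Or.inl (by linarith))
  have h3 : HasDerivAt (fun s : ℝ => Real.exp (-δ * s)) (Real.exp (-δ * s) * (-δ * 1)) s :=
    ((hasDerivAt_id s).const_mul (-δ)).exp
  refine (h3.mul h2).congr_deriv ?_
  unfold profileDeriv; ring

theorem continuousOn_profileDeriv {α δ L : ℝ} (hL : 0 < L) :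
    ContinuousOn (profileDeriv α δ L) (Icc 0 (L / 2)) := by
  have hb : ∀ s ∈ Icc 0 (L / 2), 1 - s / L ≠ 0 := fun s hs => by
    have := half_le_one_sub_div hL hs.2; linarith
  have h1 : ∀ β : ℝ, ContinuousOn (fun s : ℝ => (1 - s / L) ^ β) (Icc 0 (L / 2)) := fun β =>
    ContinuousOn.rpow_const (by fun_prop) (fun s hs => Or.inl (hb s hs))
  unfold profileDeriv
  have h2 : ContinuousOn (fun s : ℝ => Real.exp (-δ * s)) (Icc 0 (L / 2)) := by fun_prop
  exact (h2.mul (((h1 α).const_smul δ).add (((h1 (α - 1)).const_smul α).div_const L))).neg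

/-- The density `-profileDeriv` agrees with `δ * exp (-δ * s)` up to `O(1 / L)` uniformly on
`[0, L / 2]`, and exactly when `α = 0`. -/
theorem abs_profileDeriv_add_le {α δ L s : ℝ} (hδ : 0 < δ) (hL : 0 < L) (h0 : 0 ≤ s)
    (h : s ≤ L / 2) :
    |-profileDeriv α δ L s - δ * Real.exp (-δ * s)| ≤ 2 * powLip α / L := by
  have hb := half_le_one_sub_div hL h
  have hb1 := one_sub_div_le_one hL h0
  have e1 := abs_rpow_sub_one_le hb hb1 α
  have e2 := abs_mul_rpow_le_powLip hb hb1 α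
  have hP := powLip_nonneg α
  set b := 1 - s / L with hbdef
  have hexp : Real.exp (-δ * s) ≤ 1 := Real.exp_le_one_iff.2 (by nlinarith)
  have hexp0 := (Real.exp_pos (-δ * s)).le
  have hse : δ * s * Real.exp (-δ * s) ≤ 1 := by
    have h1 : δ * s ≤ Real.exp (δ * s) := by linarith [Real.add_one_le_exp (δ * s)]
    calc δ * s * Real.exp (-δ * s) ≤ Real.exp (δ * s) * Real.exp (-δ * s) :=
          mul_le_mul_of_nonneg_right h1 hexp0
      _ = 1 := by rw [← Real.exp_add]; simp
  have hid : -profileDeriv α δ L s - δ * Real.exp (-δ * s) =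
      δ * Real.exp (-δ * s) * (b ^ α - 1) + Real.exp (-δ * s) * (α * b ^ (α - 1)) / L := by
    unfold profileDeriv; rw [← hbdef]; ring
  rw [hid]
  refine (abs_add_le _ _).trans ?_
  have t1 : |δ * Real.exp (-δ * s) * (b ^ α - 1)| ≤ powLip α / L := by
    rw [abs_mul, abs_of_nonneg (by positivity)]
    calc δ * Real.exp (-δ * s) * |b ^ α - 1|
        ≤ δ * Real.exp (-δ * s) * (powLip α * (s / L)) := by
          apply mul_le_mul_of_nonneg_left _ (by positivity)
          have : s / L = 1 - b := by rw [hbdef]; ring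
          rw [this]; exact e1
      _ = (δ * s * Real.exp (-δ * s)) * (powLip α / L) := by ring
      _ ≤ 1 * (powLip α / L) := mul_le_mul_of_nonneg_right hse (by positivity)
      _ = powLip α / L := one_mul _
  have t2 : |Real.exp (-δ * s) * (α * b ^ (α - 1)) / L| ≤ powLip α / L := by
    rw [abs_div, abs_of_pos hL, abs_mul, abs_of_nonneg hexp0]
    apply div_le_div_of_nonneg_right _ hL.le
    nlinarith [abs_nonneg (α * b ^ (α - 1))]
  calc _ ≤ powLip α / L + powLip α / L := add_le_add t1 t2
    _ = 2 * powLip α / L := by ring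

/-! ### Comparison with the exponential law -/

/-- Summation by parts: a finite weighted sum of values of `φ` is the integral of `φ'` against the
tail function of the weights. -/
theorem sum_mul_eq_integral_deriv_mul {ι : Type*} (S : Finset ι) (w u : ι → ℝ) {φ : ℝ → ℝ}
    (hφ : ContDiff ℝ 1 φ) (hc : HasCompactSupport φ) :
    Integrable (fun s => deriv φ s * ∑ i ∈ S with s ≤ u i, w i) ∧
      ∑ i ∈ S, w i * φ (u i) = ∫ s, deriv φ s * ∑ i ∈ S with s ≤ u i, w i := by
  have hint : Integrable (deriv φ) :=
    (hφ.continuous_deriv le_rfl).integrable_of_hasCompactSupport hc.deriv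
  have hfun : (fun s => deriv φ s * ∑ i ∈ S with s ≤ u i, w i) =
      fun s => ∑ i ∈ S, w i * (Iic (u i)).indicator (deriv φ) s := by
    funext s
    rw [Finset.sum_filter, Finset.mul_sum]
    refine Finset.sum_congr rfl fun i _ => ?_
    by_cases hs : s ≤ u i <;> simp [hs, mul_comm]
  have hi : ∀ i ∈ S, Integrable (fun s => w i * (Iic (u i)).indicator (deriv φ) s) := fun i _ =>
    (hint.indicator measurableSet_Iic).const_mul _
  rw [hfun]
  refine ⟨integrable_finsetSum _ hi, ?_⟩
  rw [integral_finsetSum _ hi]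
  refine Finset.sum_congr rfl fun i _ => ?_
  rw [integral_const_mul, integral_indicator measurableSet_Iic, hc.integral_Iic_deriv_eq hφ]

theorem abs_le_integral_abs_deriv {φ : ℝ → ℝ} (hφ : ContDiff ℝ 1 φ) (hc : HasCompactSupport φ)
    (x : ℝ) : |φ x| ≤ ∫ s, |deriv φ s| := by
  have hint : Integrable (deriv φ) :=
    (hφ.continuous_deriv le_rfl).integrable_of_hasCompactSupport hc.deriv
  rw [← hc.integral_Iic_deriv_eq hφ]
  exact (abs_integral_le_integral_abs).trans
    (setIntegral_le_integral hint.abs (ae_of_all _ fun s => abs_nonneg _))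

/-- Integration by parts on `[0, L / 2]`. The truncation of the profile produces the boundary term
at `L / 2`. -/
theorem integral_deriv_mul_truncProfile {α δ L : ℝ} (hL : 0 < L) {φ : ℝ → ℝ}
    (hφ : ContDiff ℝ 1 φ) (hc : HasCompactSupport φ) :
    Integrable (fun s => deriv φ s * truncProfile α δ L s) ∧
      ∫ s, deriv φ s * truncProfile α δ L s =
        φ (L / 2) * profile α δ L (L / 2) + ∫ s in Ioc 0 (L / 2), φ s * -profileDeriv α δ L s := by
  have hcd : Continuous (deriv φ) := hφ.continuous_deriv le_rfl
  have hint : Integrable (deriv φ) := hcd.integrable_of_hasCompactSupport hc.deriv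
  have hL2 : (0 : ℝ) ≤ L / 2 := by positivity
  have hp : ContinuousOn (profile α δ L) (Icc 0 (L / 2)) := fun s hs =>
    (hasDerivAt_profile hL hs.2).continuousAt.continuousWithinAt
  have hfun : (fun s => deriv φ s * truncProfile α δ L s) = fun s =>
      (Iic 0).indicator (deriv φ) s +
        (Ioc 0 (L / 2)).indicator (fun s => deriv φ s * profile α δ L s) s := by
    funext s
    by_cases h0 : s ≤ 0
    · simp [truncProfile, h0, indicator]
    · by_cases h1 : s ≤ L / 2 <;> simp [truncProfile, h0, h1, indicator, not_le.1 h0]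
  have i1 : Integrable ((Iic (0 : ℝ)).indicator (deriv φ)) := hint.indicator measurableSet_Iic
  have i2' : IntegrableOn (fun s => deriv φ s * profile α δ L s) (Ioc 0 (L / 2)) :=
    ((hcd.continuousOn.mul hp).integrableOn_Icc).mono_set Ioc_subset_Icc_self
  have i2 : Integrable ((Ioc 0 (L / 2)).indicator (fun s => deriv φ s * profile α δ L s)) :=
    i2'.integrable_indicator measurableSet_Ioc
  rw [hfun]
  refine ⟨i1.add i2, ?_⟩
  rw [integral_add i1 i2, integral_indicator measurableSet_Iic,
    integral_indicator measurableSet_Ioc, hc.integral_Iic_deriv_eq hφ,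
    ← intervalIntegral.integral_of_le hL2, ← intervalIntegral.integral_of_le hL2]
  have hparts := intervalIntegral.integral_mul_deriv_eq_deriv_mul (a := 0) (b := L / 2)
    (u := φ) (v := profile α δ L) (u' := deriv φ) (v' := profileDeriv α δ L)
    (fun s _ => (hφ.differentiable one_ne_zero s).hasDerivAt)
    (fun s hs => hasDerivAt_profile hL (by rw [uIcc_of_le hL2] at hs; exact hs.2))
    (hcd.intervalIntegrable _ _)
    (ContinuousOn.intervalIntegrable (by rw [uIcc_of_le hL2]; exact continuousOn_profileDeriv hL))
  have h0 : profile α δ L 0 = 1 := by simp [profile]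
  simp only [mul_neg, intervalIntegral.integral_neg]
  rw [hparts, h0]; ring

/-- One-variable comparison: if the tail function of a finite weighted set is uniformly within `D`
of the truncated profile, then sums over the set are close to integrals against the exponential
law of parameter `δ` on `]0, +∞[`. The distance `D` is only paid against the total variation of
`φ`, so that a rescaling of `φ` does not affect it. -/
theorem abs_sum_sub_integral_exp_le {ι : Type*} (S : Finset ι) (w u : ι → ℝ) {α δ L D : ℝ}
    (hδ : 0 < δ) (hL : 0 < L)
    (hD : ∀ s, |∑ i ∈ S with s ≤ u i, w i - truncProfile α δ L s| ≤ D)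
    {φ : ℝ → ℝ} (hφ : ContDiff ℝ 1 φ) (hc : HasCompactSupport φ) :
    |∑ i ∈ S, w i * φ (u i) - ∫ s in Ioi 0, φ s * (δ * Real.exp (-δ * s))| ≤
      (D + 2 ^ |α| * Real.exp (-δ * (L / 2))) * (∫ s, |deriv φ s|) +
      (2 * powLip α / L + δ * Real.exp (-δ * (L / 2))) * ∫ s, |φ s| := by
  obtain ⟨i1, e1⟩ := sum_mul_eq_integral_deriv_mul S w u hφ hc
  obtain ⟨i2, e2⟩ := integral_deriv_mul_truncProfile (α := α) (δ := δ) hL hφ hc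
  have hcd : Continuous (deriv φ) := hφ.continuous_deriv le_rfl
  have hint : Integrable (deriv φ) := hcd.integrable_of_hasCompactSupport hc.deriv
  have hintφ : Integrable φ := hφ.continuous.integrable_of_hasCompactSupport hc
  have hL2 : (0 : ℝ) ≤ L / 2 := by positivity
  set g : ℝ → ℝ := fun s => φ s * (δ * Real.exp (-δ * s)) with hg
  have hgc : Continuous g := hφ.continuous.mul (by fun_prop)
  have hgi : Integrable g := hgc.integrable_of_hasCompactSupport hc.mul_right
  set q : ℝ → ℝ := fun s => φ s * -profileDeriv α δ L s with hq
  have hqi : IntegrableOn q (Ioc 0 (L / 2)) :=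
    ((hφ.continuous.continuousOn.mul (continuousOn_profileDeriv hL).neg).integrableOn_Icc).mono_set
      Ioc_subset_Icc_self
  have hsplit : ∫ s in Ioi 0, g s = (∫ s in Ioc 0 (L / 2), g s) + ∫ s in Ioi (L / 2), g s := by
    rw [← Ioc_union_Ioi_eq_Ioi hL2]
    exact setIntegral_union (f := g) (by
      rw [Set.disjoint_left]; intro s hs hs'; exact absurd hs.2 (not_le.2 hs'))
      measurableSet_Ioi hgi.integrableOn hgi.integrableOn
  have d1 : |∑ i ∈ S, w i * φ (u i) - ∫ s, deriv φ s * truncProfile α δ L s| ≤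
      D * ∫ s, |deriv φ s| := by
    rw [e1, ← integral_sub i1 i2, ← integral_const_mul, ← Real.norm_eq_abs]
    refine norm_integral_le_of_norm_le (hint.abs.const_mul D) (ae_of_all _ fun s => ?_)
    rw [← mul_sub, norm_mul, mul_comm, Real.norm_eq_abs, Real.norm_eq_abs]
    exact mul_le_mul_of_nonneg_right (hD s) (abs_nonneg _)
  have d2 : |φ (L / 2) * profile α δ L (L / 2)| ≤
      2 ^ |α| * Real.exp (-δ * (L / 2)) * ∫ s, |deriv φ s| := by
    rw [abs_mul, abs_of_nonneg (profile_nonneg hL le_rfl), mul_comm]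
    exact mul_le_mul (profile_le hL hL2 le_rfl) (abs_le_integral_abs_deriv hφ hc _)
      (abs_nonneg _) (by positivity)
  have d3 : |(∫ s in Ioc 0 (L / 2), q s) - ∫ s in Ioc 0 (L / 2), g s| ≤
      2 * powLip α / L * ∫ s, |φ s| := by
    rw [← integral_sub hqi hgi.integrableOn, ← Real.norm_eq_abs]
    calc ‖∫ s in Ioc 0 (L / 2), (q s - g s)‖
        ≤ ∫ s in Ioc 0 (L / 2), 2 * powLip α / L * |φ s| := by
          refine norm_integral_le_of_norm_le (hintφ.abs.const_mul _).integrableOn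
            ((ae_restrict_iff' measurableSet_Ioc).2 (ae_of_all _ fun s hs => ?_))
          rw [hq, hg]
          simp only
          rw [← mul_sub, norm_mul, mul_comm, Real.norm_eq_abs, Real.norm_eq_abs]
          exact mul_le_mul_of_nonneg_right (abs_profileDeriv_add_le hδ hL hs.1.le hs.2)
            (abs_nonneg _)
      _ ≤ ∫ s, 2 * powLip α / L * |φ s| := by
          refine setIntegral_le_integral (hintφ.abs.const_mul _) (ae_of_all _ fun s => ?_)
          have := powLip_nonneg α
          simp only [Pi.zero_apply]; positivity
      _ = _ := integral_const_mul _ _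
  have d4 : |∫ s in Ioi (L / 2), g s| ≤ δ * Real.exp (-δ * (L / 2)) * ∫ s, |φ s| := by
    rw [← Real.norm_eq_abs]
    calc ‖∫ s in Ioi (L / 2), g s‖
        ≤ ∫ s in Ioi (L / 2), δ * Real.exp (-δ * (L / 2)) * |φ s| := by
          refine norm_integral_le_of_norm_le (hintφ.abs.const_mul _).integrableOn
            ((ae_restrict_iff' measurableSet_Ioi).2 (ae_of_all _ fun s hs => ?_))
          rw [hg]
          simp only
          rw [norm_mul, mul_comm, Real.norm_eq_abs, Real.norm_eq_abs,
            abs_of_nonneg (by positivity : 0 ≤ δ * Real.exp (-δ * s))]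
          refine mul_le_mul_of_nonneg_right (mul_le_mul_of_nonneg_left
            (Real.exp_le_exp.2 ?_) hδ.le) (abs_nonneg _)
          have : L / 2 < s := hs
          nlinarith
      _ ≤ ∫ s, δ * Real.exp (-δ * (L / 2)) * |φ s| := by
          refine setIntegral_le_integral (hintφ.abs.const_mul _) (ae_of_all _ fun s => ?_)
          simp only [Pi.zero_apply]; positivity
      _ = _ := integral_const_mul _ _
  rw [e2] at d1
  rw [hsplit]
  rw [abs_le] at *
  constructor <;> linarith [d1.1, d1.2, d2.1, d2.2, d3.1, d3.2, d4.1, d4.2]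

/-! ### Pairs of points and the Laplace law -/

/-- If two independent variables follow the exponential law of parameter `δ`, then their difference
follows the Laplace law, of density `expDensity δ`. -/
theorem integral_integral_exp_sub {δ : ℝ} (hδ : 0 < δ) {F : ℝ → ℝ} (hF : Continuous F)
    (hc : HasCompactSupport F) :
    IntegrableOn (fun s => (∫ v in Ioi 0, F (s - v) * (δ * Real.exp (-δ * v))) *
        (δ * Real.exp (-δ * s))) (Ioi 0) ∧
      ∫ s in Ioi 0, (∫ v in Ioi 0, F (s - v) * (δ * Real.exp (-δ * v))) *
        (δ * Real.exp (-δ * s)) = ∫ t, F t * expDensity δ t := by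
  set k : ℝ → ℝ := fun s => δ * Real.exp (-δ * s) with hk
  have hkc : Continuous k := by fun_prop
  have hk0 : ∀ s, 0 ≤ k s := fun s => by positivity
  have hki : IntegrableOn k (Ioi 0) :=
    (integrableOn_exp_mul_Ioi (neg_lt_zero.2 hδ) 0).const_mul δ
  have hFi : Integrable F := hF.integrable_of_hasCompactSupport hc
  set H : ℝ → ℝ → ℝ := fun s t => (Ioi (max 0 t)).indicator (fun s => F t * k (s - t) * k s) s
    with hH
  have hms : MeasurableSet {p : ℝ × ℝ | max 0 p.2 < p.1} :=
    measurableSet_lt (by fun_prop) (by fun_prop)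
  have hHint : Integrable (Function.uncurry H) (volume.prod volume) := by
    have hdom := ((hki.integrable_indicator measurableSet_Ioi).mul_prod
      (hFi.abs.const_mul δ) : Integrable _ (volume.prod volume))
    have hunc : Function.uncurry H = {p : ℝ × ℝ | max 0 p.2 < p.1}.indicator
        (fun p => F p.2 * k (p.1 - p.2) * k p.1) := by
      funext p
      rcases p with ⟨s, t⟩
      simp only [hH, Function.uncurry, indicator, mem_Ioi, mem_ofPred_eq]
    refine hdom.mono ?_ (ae_of_all _ ?_)
    · rw [hunc]
      exact (Continuous.measurable (by fun_prop)).aestronglyMeasurable.indicator hms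
    · rintro ⟨s, t⟩
      simp only [hH, Function.uncurry]
      by_cases h : max 0 t < s
      · have h0 : 0 < s := (le_max_left _ _).trans_lt h
        have ht : t < s := (le_max_right _ _).trans_lt h
        rw [indicator_of_mem (show s ∈ Ioi (max 0 t) from h),
          indicator_of_mem (show s ∈ Ioi 0 from h0)]
        rw [Real.norm_of_nonneg (mul_nonneg (hk0 s) (mul_nonneg hδ.le (abs_nonneg (F t)))),
          norm_mul, norm_mul, Real.norm_of_nonneg (hk0 _), Real.norm_of_nonneg (hk0 _),
          Real.norm_eq_abs]
        have : k (s - t) ≤ δ := by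
          have : Real.exp (-δ * (s - t)) ≤ 1 := Real.exp_le_one_iff.2 (by nlinarith)
          simp only [hk]; nlinarith
        calc |F t| * k (s - t) * k s ≤ |F t| * δ * k s :=
              mul_le_mul_of_nonneg_right
                (mul_le_mul_of_nonneg_left this (abs_nonneg _)) (hk0 s)
          _ = k s * (δ * |F t|) := by ring
      · rw [indicator_of_notMem (show s ∉ Ioi (max 0 t) from h), norm_zero]
        exact norm_nonneg _
  -- the substitution `t = s - v` in the inner integral
  have hinner : ∀ s, ∫ t, H s t =
      (Ioi 0).indicator (fun s => (∫ v in Ioi 0, F (s - v) * k v) * k s) s := by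
    intro s
    by_cases h0 : 0 < s
    · rw [indicator_of_mem (show s ∈ Ioi 0 from h0), ← integral_mul_const,
        ← integral_indicator measurableSet_Ioi, ← integral_sub_left_eq_self _ _ s]
      congr 1
      funext v
      simp only [hH, indicator, mem_Ioi, max_lt_iff, h0, true_and, sub_sub_cancel, sub_lt_self_iff]
    · rw [indicator_of_notMem (show s ∉ Ioi 0 from h0)]
      have : ∀ t, H s t = 0 := fun t => indicator_of_notMem (fun h =>
        h0 ((le_max_left (0 : ℝ) t).trans_lt h)) _
      simp [this]
  have houter : ∀ t, ∫ s, H s t = F t * expDensity δ t := by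
    intro t
    simp only [hH]
    rw [integral_indicator measurableSet_Ioi]
    have : ∀ s, F t * k (s - t) * k s =
        F t * (δ ^ 2 * Real.exp (δ * t)) * Real.exp ((-2 * δ) * s) := by
      intro s
      have : Real.exp (-δ * (s - t)) * Real.exp (-δ * s) =
          Real.exp (δ * t) * Real.exp (-2 * δ * s) := by
        rw [← Real.exp_add, ← Real.exp_add]; ring_nf
      simp only [hk]
      linear_combination (F t * δ ^ 2) * this
    simp only [this]
    rw [integral_const_mul, integral_exp_mul_Ioi (by linarith : -2 * δ < 0)]
    have h2 : Real.exp (δ * t) * Real.exp (-2 * δ * max 0 t) = Real.exp (-δ * |t|) := by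
      rw [← Real.exp_add]
      congr 1
      rcases le_total 0 t with h | h
      · rw [max_eq_right h, abs_of_nonneg h]; ring
      · rw [max_eq_left h, abs_of_nonpos h]; ring
    unfold expDensity
    rw [← h2]
    field_simp
  constructor
  · rw [← integrable_indicator_iff measurableSet_Ioi]
    exact hHint.integral_prod_left.congr (ae_of_all _ hinner)
  · rw [← integral_indicator measurableSet_Ioi]
    refine (integral_congr_ae (ae_of_all _ fun s => (hinner s).symm)).trans ?_
    rw [integral_integral_swap hHint]
    simp only [houter]

/-- Pair comparison: replacing the two copies of a weighted finite set one after the other by the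
exponential law turns its pair correlations into an integral against the Laplace density. -/
theorem abs_sum_sum_sub_integral_expDensity_le {ι : Type*} (S : Finset ι) (w u : ι → ℝ)
    (hw : ∀ i ∈ S, 0 ≤ w i) {α δ L D : ℝ} (hδ : 0 < δ) (hL : 0 < L)
    (hD : ∀ s, |∑ i ∈ S with s ≤ u i, w i - truncProfile α δ L s| ≤ D)
    {F : ℝ → ℝ} (hF : ContDiff ℝ 1 F) (hc : HasCompactSupport F) :
    |∑ i ∈ S, ∑ j ∈ S, w i * w j * F (u i - u j) - ∫ t, F t * expDensity δ t| ≤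
      ((D + 2 ^ |α| * Real.exp (-δ * (L / 2))) * (∫ s, |deriv F s|) +
      (2 * powLip α / L + δ * Real.exp (-δ * (L / 2))) * ∫ s, |F s|) * (∑ i ∈ S, w i + 1) := by
  set B := (D + 2 ^ |α| * Real.exp (-δ * (L / 2))) * (∫ s, |deriv F s|) +
      (2 * powLip α / L + δ * Real.exp (-δ * (L / 2))) * ∫ s, |F s| with hB
  set k : ℝ → ℝ := fun s => δ * Real.exp (-δ * s) with hk
  have hkc : Continuous k := by fun_prop
  have hk0 : ∀ s, 0 ≤ k s := fun s => by positivity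
  have hki : IntegrableOn k (Ioi 0) :=
    (integrableOn_exp_mul_Ioi (neg_lt_zero.2 hδ) 0).const_mul δ
  have hk1 : ∫ s in Ioi 0, k s = 1 := by
    rw [hk, integral_const_mul, integral_exp_mul_Ioi (neg_lt_zero.2 hδ)]
    simp [hδ.ne']
  obtain ⟨mi, me⟩ := integral_integral_exp_sub hδ hF.continuous hc
  have c1 : ∀ v, HasCompactSupport fun s => F (s - v) := fun v =>
    hc.comp_homeomorph (Homeomorph.subRight v)
  have c2 : ∀ v, HasCompactSupport fun s => F (v - s) := fun v =>
    hc.comp_homeomorph (Homeomorph.subLeft v)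
  have h1 : ∀ v, |∑ i ∈ S, w i * F (u i - v) - ∫ s in Ioi 0, F (s - v) * k s| ≤ B := by
    intro v
    have h := abs_sum_sub_integral_exp_le S w u hδ hL hD
      (φ := fun s => F (s - v)) (by fun_prop) (c1 v)
    simp only [deriv_comp_sub_const] at h
    rwa [integral_sub_right_eq_self (fun s => |deriv F s|) v,
      integral_sub_right_eq_self (fun s => |F s|) v] at h
  have h2 : ∀ v, |∑ j ∈ S, w j * F (v - u j) - ∫ s in Ioi 0, F (v - s) * k s| ≤ B := by
    intro v
    have h := abs_sum_sub_integral_exp_le S w u hδ hL hD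
      (φ := fun s => F (v - s)) (by fun_prop) (c2 v)
    simp only [deriv_comp_const_sub, abs_neg] at h
    rwa [integral_sub_left_eq_self (fun s => |deriv F s|) volume v,
      integral_sub_left_eq_self (fun s => |F s|) volume v] at h
  have ki : ∀ j ∈ S, IntegrableOn (fun s => w j * (F (s - u j) * k s)) (Ioi 0) := fun j _ =>
    ((((hF.continuous.comp (continuous_id.sub continuous_const)).mul
      hkc).integrable_of_hasCompactSupport (c1 (u j)).mul_right).const_mul _).integrableOn
  have s1 : |∑ i ∈ S, ∑ j ∈ S, w i * w j * F (u i - u j) -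
      ∑ j ∈ S, w j * ∫ s in Ioi 0, F (s - u j) * k s| ≤ B * ∑ i ∈ S, w i := by
    rw [Finset.sum_comm, ← Finset.sum_sub_distrib, Finset.mul_sum]
    refine (Finset.abs_sum_le_sum_abs _ _).trans (Finset.sum_le_sum fun j hj => ?_)
    have : ∑ i ∈ S, w i * w j * F (u i - u j) = w j * ∑ i ∈ S, w i * F (u i - u j) := by
      rw [Finset.mul_sum]; exact Finset.sum_congr rfl fun i _ => by ring
    rw [this, ← mul_sub, abs_mul, abs_of_nonneg (hw j hj), mul_comm]
    exact mul_le_mul_of_nonneg_right (h1 (u j)) (hw j hj)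
  have s2 : |∑ j ∈ S, w j * (∫ s in Ioi 0, F (s - u j) * k s) - ∫ t, F t * expDensity δ t| ≤
      B := by
    have e : ∑ j ∈ S, w j * (∫ s in Ioi 0, F (s - u j) * k s) =
        ∫ s in Ioi 0, ∑ j ∈ S, w j * (F (s - u j) * k s) := by
      rw [integral_finsetSum _ ki]
      exact Finset.sum_congr rfl fun j _ => (integral_const_mul _ _).symm
    rw [e, ← me, ← integral_sub (integrable_finsetSum _ ki) mi, ← Real.norm_eq_abs]
    calc _ ≤ ∫ s in Ioi 0, B * k s := by
          refine norm_integral_le_of_norm_le (hki.const_mul B) (ae_of_all _ fun s => ?_)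
          have : ∑ j ∈ S, w j * (F (s - u j) * k s) = (∑ j ∈ S, w j * F (s - u j)) * k s := by
            rw [Finset.sum_mul]; exact Finset.sum_congr rfl fun i _ => by ring
          rw [this, ← sub_mul, norm_mul, Real.norm_eq_abs, Real.norm_eq_abs, abs_of_nonneg (hk0 s)]
          exact mul_le_mul_of_nonneg_right (h2 s) (hk0 s)
      _ = B := by rw [integral_const_mul, hk1, mul_one]
  refine (abs_sub_le _ _ _).trans ((add_le_add s1 s2).trans (le_of_eq ?_))
  ring

/-! ### Normalised tails of the weighted set -/

theorem mem_truncation {E : Set ℝ} {hE : IsLocallyFiniteSet E} {hE0 : E ⊆ Ici 0} {t x : ℝ} :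
    x ∈ truncation E hE hE0 t ↔ x ∈ E ∧ x ≤ t := by
  simp [truncation]

theorem growthFunction_nonneg {E : Set ℝ} (hE : IsLocallyFiniteSet E) (hE0 : E ⊆ Ici 0)
    {ω : ℝ → ℝ} (hω : ∀ x ∈ E, 0 < ω x) (t : ℝ) : 0 ≤ growthFunction E hE hE0 ω t :=
  Finset.sum_nonneg fun x hx => (hω x (mem_truncation.1 hx).1).le

theorem growthFunction_mono {E : Set ℝ} (hE : IsLocallyFiniteSet E) (hE0 : E ⊆ Ici 0)
    {ω : ℝ → ℝ} (hω : ∀ x ∈ E, 0 < ω x) : Monotone (growthFunction E hE hE0 ω) := by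
  intro s t hst
  refine Finset.sum_le_sum_of_subset_of_nonneg (fun x hx => ?_)
    fun x hx _ => (hω x (mem_truncation.1 hx).1).le
  rw [mem_truncation] at hx ⊢
  exact ⟨hx.1, hx.2.trans hst⟩

theorem sum_filter_truncation {E : Set ℝ} (hE : IsLocallyFiniteSet E) (hE0 : E ⊆ Ici 0)
    (ω : ℝ → ℝ) (L s : ℝ) :
    ∑ x ∈ truncation E hE hE0 L with s ≤ L - x, ω x =
      growthFunction E hE hE0 ω (min L (L - s)) := by
  refine Finset.sum_congr (Finset.ext fun x => ?_) fun _ _ => rfl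
  rw [Finset.mem_filter, mem_truncation, mem_truncation, le_min_iff, le_sub_comm, and_assoc]

theorem mul_profile {α c δ L s : ℝ} (hL : 0 < L) (h : s ≤ L / 2) :
    c * (L - s) ^ α * Real.exp (δ * (L - s)) =
      c * L ^ α * Real.exp (δ * L) * profile α δ L s := by
  have hb := half_le_one_sub_div hL h
  have e1 : (L - s) ^ α = L ^ α * (1 - s / L) ^ α := by
    rw [← Real.mul_rpow hL.le (by linarith)]
    congr 1; field_simp
  have e2 : Real.exp (δ * (L - s)) = Real.exp (δ * L) * Real.exp (-δ * s) := by
    rw [← Real.exp_add]; ring_nf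
  rw [e1, e2, profile]; ring

/-- The growth assumption, seen from the point `N`: the tails of the weights normalised by
`Φ = c * N ^ α * exp (δ * N)` are exponentially close to the truncated profile. -/
theorem exists_abs_tail_sub_truncProfile_le {E : Set ℝ} (hE0 : E ⊆ Ici 0)
    (hE : IsLocallyFiniteSet E) {ω : ℝ → ℝ} (hω : ∀ x ∈ E, 0 < ω x) {α c δ κ : ℝ}
    (hc : 0 < c) (hδ : 0 < δ) (hκ : 0 < κ)
    (hgrowth : ∃ r : ℝ → ℝ, r =O[atTop] (fun t : ℝ => Real.exp (-κ * t)) ∧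
      ∀ᶠ t : ℝ in atTop,
        growthFunction E hE hE0 ω t = c * t ^ α * Real.exp (δ * t) * (1 + r t)) :
    ∃ K : ℝ, 0 < K ∧ ∀ᶠ N : ℕ in atTop, ∃ Φ : ℝ, 0 < Φ ∧
      1 / 2 ≤ growthFunction E hE hE0 ω N / Φ ∧
      ∀ s : ℝ, |∑ x ∈ truncation E hE hE0 N with s ≤ (N : ℝ) - x, ω x / Φ -
        truncProfile α δ N s| ≤ K * Real.exp (-(min κ δ / 2) * N) := by
  obtain ⟨r, hr, hG⟩ := hgrowth
  obtain ⟨K, hK, hr⟩ := hr.exists_pos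
  rw [IsBigOWith] at hr
  obtain ⟨t₀, ht₀⟩ := eventually_atTop.1 (hr.and hG)
  set K' := 2 ^ |α| * (1 + K) with hK'
  have hpow : (1 : ℝ) ≤ 2 ^ |α| := Real.one_le_rpow one_le_two (abs_nonneg α)
  have hK1 : K ≤ K' := by nlinarith
  have hm1 : min κ δ ≤ κ := min_le_left _ _
  have hm2 : min κ δ ≤ δ := min_le_right _ _
  have hm0 : 0 < min κ δ := lt_min hκ hδ
  set m := min κ δ
  refine ⟨K', by positivity, ?_⟩
  have hlim : Tendsto (fun N : ℕ => K' * Real.exp (-(m / 2) * N)) atTop (𝓝 0) := by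
    rw [← mul_zero K']
    refine Tendsto.const_mul _ (Real.tendsto_exp_atBot.comp ?_)
    exact tendsto_natCast_atTop_atTop.const_mul_atTop_of_neg (by linarith)
  filter_upwards [hlim.eventually (ge_mem_nhds (show (0 : ℝ) < 1 / 2 by norm_num)),
    eventually_ge_atTop 1, eventually_ge_atTop ⌈2 * t₀⌉₊] with N hsmall hN1 hNt
  have hN0 : (0 : ℝ) < N := by exact_mod_cast hN1
  have hNt' : 2 * t₀ ≤ N := Nat.ceil_le.1 hNt
  set L : ℝ := (N : ℝ)
  set Φ := c * L ^ α * Real.exp (δ * L) with hΦ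
  have hΦ0 : 0 < Φ := mul_pos (mul_pos hc (Real.rpow_pos_of_pos hN0 _)) (Real.exp_pos _)
  have hexpm : ∀ t, L / 2 ≤ t → |r t| ≤ K * Real.exp (-(m / 2) * L) := by
    intro t ht
    have h := (ht₀ t (by linarith)).1
    rw [Real.norm_eq_abs, Real.norm_of_nonneg (Real.exp_pos _).le] at h
    refine h.trans (mul_le_mul_of_nonneg_left (Real.exp_le_exp.2 ?_) hK.le)
    nlinarith
  have hGs : ∀ s, s ≤ L / 2 →
      growthFunction E hE hE0 ω (L - s) / Φ = profile α δ L s * (1 + r (L - s)) := by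
    intro s hs
    rw [(ht₀ (L - s) (by linarith)).2, mul_profile hN0 hs, ← hΦ]
    field_simp
  have hprof0 : profile α δ L 0 = 1 := by simp [profile]
  have hG0 : growthFunction E hE hE0 ω L / Φ = 1 + r L := by
    have := hGs 0 (by positivity)
    rwa [sub_zero, hprof0, one_mul] at this
  have hE1 : 0 < Real.exp (-(m / 2) * L) := Real.exp_pos _
  have hE2 : Real.exp (-(m / 2) * L) ≤ 1 := Real.exp_le_one_iff.2 (by nlinarith)
  refine ⟨Φ, hΦ0, ?_, fun s => ?_⟩
  · rw [hG0]
    have := (abs_le.1 (hexpm L (by linarith))).1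
    nlinarith
  · rw [← Finset.sum_div, sum_filter_truncation]
    rcases le_or_gt s 0 with h0 | h0
    · rw [min_eq_left (by linarith), hG0, truncProfile, if_pos h0, add_sub_cancel_left]
      exact (hexpm L (by linarith)).trans (mul_le_mul_of_nonneg_right hK1 hE1.le)
    · rw [min_eq_right (by linarith), truncProfile, if_neg (not_le.2 h0)]
      rcases le_or_gt s (L / 2) with h1 | h1
      · rw [if_pos h1, hGs s h1]
        have hp := profile_nonneg (α := α) (δ := δ) hN0 h1
        have hp2 : profile α δ L s ≤ 2 ^ |α| :=
          (profile_le hN0 h0.le h1).trans (mul_le_of_le_one_right (by positivity)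
            (Real.exp_le_one_iff.2 (by nlinarith)))
        rw [mul_add, mul_one, add_sub_cancel_left, abs_mul, abs_of_nonneg hp]
        calc _ ≤ 2 ^ |α| * (K * Real.exp (-(m / 2) * L)) :=
              mul_le_mul hp2 (hexpm _ (by linarith)) (abs_nonneg _) (by positivity)
          _ ≤ K' * Real.exp (-(m / 2) * L) := by rw [hK']; nlinarith
      · rw [if_neg (not_le.2 h1), sub_zero,
          abs_of_nonneg (div_nonneg (growthFunction_nonneg hE hE0 hω _) hΦ0.le)]
        have hp := profile_nonneg (α := α) (δ := δ) hN0 le_rfl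
        calc growthFunction E hE hE0 ω (L - s) / Φ
            ≤ growthFunction E hE hE0 ω (L - L / 2) / Φ :=
              div_le_div_of_nonneg_right (growthFunction_mono hE hE0 hω (by linarith)) hΦ0.le
          _ = profile α δ L (L / 2) * (1 + r (L - L / 2)) := hGs _ le_rfl
          _ ≤ profile α δ L (L / 2) * (1 + K) := by
              apply mul_le_mul_of_nonneg_left _ hp
              have := (abs_le.1 (hexpm (L - L / 2) (by linarith))).2
              nlinarith
          _ ≤ (2 ^ |α| * Real.exp (-(m / 2) * L)) * (1 + K) := by
              apply mul_le_mul_of_nonneg_right _ (by positivity)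
              refine (profile_le hN0 (by positivity) le_rfl).trans
                (mul_le_mul_of_nonneg_left (Real.exp_le_exp.2 ?_) (by positivity))
              nlinarith
          _ = K' * Real.exp (-(m / 2) * L) := by rw [hK']; ring

/-! ### Test functions and the pair correlation measure -/

theorem abs_le_supNorm {h : ℝ → ℝ} (hh : Continuous h) (hc : HasCompactSupport h) (t : ℝ) :
    |h t| ≤ supNorm h := by
  refine le_ciSup (f := fun t => |h t|) ?_ t
  obtain ⟨B, hB⟩ := hc.exists_bound_of_continuous hh
  exact ⟨B, by rintro _ ⟨x, rfl⟩; exact hB x⟩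

theorem supNorm_nonneg (h : ℝ → ℝ) : 0 ≤ supNorm h := Real.iSup_nonneg fun t => abs_nonneg (h t)

theorem abs_integral_mul_le {h g : ℝ → ℝ} {A M : ℝ} (hA : 0 ≤ A) (hh : Continuous h)
    (hs : tsupport h ⊆ Icc (-A) A) (hM : ∀ t ∈ Icc (-A) A, |g t| ≤ M) :
    |∫ t, h t * g t| ≤ 2 * A * M * supNorm h := by
  have hc : HasCompactSupport h := isCompact_Icc.of_isClosed_subset (isClosed_tsupport h) hs
  rw [← setIntegral_eq_integral_of_forall_compl_eq_zero (s := Icc (-A) A) (fun t ht => by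
    rw [image_eq_zero_of_notMem_tsupport (fun h' => ht (hs h')), zero_mul]), ← Real.norm_eq_abs]
  refine (norm_setIntegral_le_of_norm_le_const (C := supNorm h * M) (by simp)
    fun t ht => ?_).trans (le_of_eq ?_)
  · rw [norm_mul]
    exact mul_le_mul (abs_le_supNorm hh hc t) (hM t ht) (norm_nonneg _) (supNorm_nonneg h)
  · rw [Real.volume_real_Icc_of_le (by linarith)]; ring

theorem integral_abs_le {h : ℝ → ℝ} {A : ℝ} (hA : 0 ≤ A) (hh : Continuous h)
    (hs : tsupport h ⊆ Icc (-A) A) : ∫ t, |h t| ≤ 2 * A * supNorm h := by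
  have h1 := abs_integral_mul_le (g := fun t => SignType.sign (h t)) (M := 1) hA hh hs
    (fun t _ => by rcases lt_trichotomy (h t) 0 with h | h | h <;> simp [h])
  simp only [self_mul_sign, mul_one] at h1
  exact (le_abs_self _).trans h1

theorem tsupport_deriv_subset_Icc {f : ℝ → ℝ} {A : ℝ} (hs : tsupport f ⊆ Icc (-A) A) :
    tsupport (deriv f) ⊆ Icc (-A) A :=
  (closure_minimal support_deriv_subset (isClosed_tsupport f)).trans hs

theorem integral_pairCorrelationMeasure (S : ℕ → Finset ℝ) {ω : ℝ → ℝ} (ψ : ℕ → ℝ) (N : ℕ)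
    (hω : ∀ x ∈ S N, 0 ≤ ω x) (f : ℝ → ℝ) :
    ∫ t, f t ∂(pairCorrelationMeasure S ω ψ N) =
      ∑ x ∈ S N, ∑ y ∈ S N, ω x * ω y * f (ψ N * (y - x)) := by
  have hi : ∀ x y, Integrable f
      (ENNReal.ofReal (ω x * ω y) • Measure.dirac (ψ N * (y - x))) := fun x y =>
    (integrable_dirac enorm_lt_top).smul_measure ENNReal.ofReal_ne_top
  unfold pairCorrelationMeasure
  rw [integral_finsetSum_measure fun x _ => integrable_finsetSum_measure.2 fun y _ => hi x y]
  refine Finset.sum_congr rfl fun x hx => ?_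
  rw [integral_finsetSum_measure fun y _ => hi x y]
  refine Finset.sum_congr rfl fun y hy => ?_
  rw [integral_smul_measure, integral_dirac, ENNReal.toReal_ofReal
    (mul_nonneg (hω x hx) (hω y hy)), smul_eq_mul]

/-! ### The uniform estimate and the scaling -/

/-- Effect on the error of dividing by the square of the true mass `g`, which is close to `1`. -/
theorem abs_mul_div_sq_sub_le {P X J Z g η j : ℝ} (hP : 0 < P) (hg : 1 / 2 ≤ g)
    (hη : |g - 1| ≤ η) (hX : P * |X - P⁻¹ * J| ≤ Z * (g + 1)) (hJ : |J| ≤ j) :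
    |P * X / g ^ 2 - J| ≤ 4 * (Z + η * j) * (g + 1) := by
  have hg0 : 0 < g := by linarith
  have hsplit : P * X / g ^ 2 - J = (P * (X - P⁻¹ * J) + (1 - g) * (1 + g) * J) / g ^ 2 := by
    field_simp
    ring
  have hη0 : 0 ≤ η := (abs_nonneg _).trans hη
  have hJ2 : |(1 - g) * (1 + g) * J| ≤ η * (g + 1) * j := by
    rw [abs_mul, abs_mul, abs_sub_comm, abs_of_pos (by linarith : 0 < 1 + g), add_comm 1 g]
    exact mul_le_mul (mul_le_mul_of_nonneg_right hη (by linarith)) hJ (abs_nonneg _)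
      (by positivity)
  rw [hsplit, abs_div, abs_of_pos (by positivity : 0 < g ^ 2), div_le_iff₀ (by positivity)]
  have hnum : |P * (X - P⁻¹ * J) + (1 - g) * (1 + g) * J| ≤ (Z + η * j) * (g + 1) := by
    refine (abs_add_le _ _).trans ?_
    rw [abs_mul, abs_of_pos hP]
    linarith
  have hY0 := (abs_nonneg _).trans hnum
  have hg2 : 1 / 4 ≤ g ^ 2 := by nlinarith
  calc _ ≤ (Z + η * j) * (g + 1) := hnum
    _ = 4 * ((Z + η * j) * (g + 1)) * (1 / 4) := by ring
    _ ≤ 4 * ((Z + η * j) * (g + 1)) * g ^ 2 :=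
        mul_le_mul_of_nonneg_left hg2 (by positivity)
    _ = _ := by ring

/-- Quantitative equidistribution, uniform in the scaling and the test function: the renormalised
pair correlations are close to the dilated Laplace density `t ↦ expDensity δ (t / ψ N)`. -/
theorem exists_abs_renormalisedPairCorrelation_sub_le {E : Set ℝ} (hE0 : E ⊆ Ici 0)
    (hE : IsLocallyFiniteSet E) {ω : ℝ → ℝ} (hω : ∀ x ∈ E, 0 < ω x) {α c δ κ : ℝ}
    (hc : 0 < c) (hδ : 0 < δ) (hκ : 0 < κ)
    (hgrowth : ∃ r : ℝ → ℝ, r =O[atTop] (fun t : ℝ => Real.exp (-κ * t)) ∧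
      ∀ᶠ t : ℝ in atTop,
        growthFunction E hE hE0 ω t = c * t ^ α * Real.exp (δ * t) * (1 + r t)) :
    ∃ C : ℝ, 0 < C ∧ ∀ᶠ N : ℕ in atTop, ∀ ψ : ℕ → ℝ, 1 ≤ ψ N → ∀ A : ℝ, 1 ≤ A →
      ∀ f : ℝ → ℝ, ContDiff ℝ 1 f → tsupport f ⊆ Icc (-A) A →
        |renormalisedPairCorrelation E hE hE0 ω ψ f N - ∫ t, f t * expDensity δ (t / ψ N)| ≤
          C * (ψ N * Real.exp (-(min κ δ / 2) * N) * (A * supNorm (deriv f)) +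
            (powLip α / N + Real.exp (-(min κ δ / 2) * N)) * (A * supNorm f)) := by
  obtain ⟨K, hK, hN⟩ := exists_abs_tail_sub_truncProfile_le hE0 hE hω hc hδ hκ hgrowth
  set m := min κ δ with hm
  have hm2 : m ≤ δ := min_le_right _ _
  have hm0 : 0 < m := lt_min hκ hδ
  set T : ℝ := 2 ^ |α| with hT
  have hT0 : 0 < T := by positivity
  refine ⟨4 * (K + 2) * (2 * (K + T) + 4 + 2 * δ + K * δ), by positivity, ?_⟩
  filter_upwards [hN, eventually_ge_atTop 1] with N hN hN1 ψ hψ A hA f hf hs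
  obtain ⟨Φ, hΦ, hg, htail⟩ := hN
  have hN0 : (0 : ℝ) < N := by exact_mod_cast hN1
  set P := ψ N with hP
  have hP0 : 0 < P := by linarith
  have hcf : HasCompactSupport f := isCompact_Icc.of_isClosed_subset (isClosed_tsupport f) hs
  set S := truncation E hE hE0 (N : ℝ) with hS
  have hωS : ∀ x ∈ S, 0 ≤ ω x := fun x hx => (hω x (mem_truncation.1 hx).1).le
  set G := growthFunction E hE hE0 ω (N : ℝ) with hG
  set e := Real.exp (-(m / 2) * N) with he
  have he0 : 0 < e := Real.exp_pos _
  have he1 : e ≤ 1 := Real.exp_le_one_iff.2 (by nlinarith)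
  have hδe : Real.exp (-δ * (N / 2)) ≤ e := Real.exp_le_exp.2 (by nlinarith)
  -- the total normalised weight, equal to `1` up to an exponentially small error
  have hsumW : ∑ x ∈ S, ω x / Φ = G / Φ := by rw [← Finset.sum_div]; rfl
  set g := G / Φ with hgdef
  have hg1 : |g - 1| ≤ K * e := by
    have := htail 0
    rwa [Finset.filter_true_of_mem (fun x hx => by
      have := (mem_truncation.1 hx).2; linarith), hsumW, truncProfile, if_pos le_rfl] at this
  have hgK : g ≤ 1 + K := by have := (abs_le.1 hg1).2; nlinarith
  -- the rescaled test function
  set F : ℝ → ℝ := fun t => f (P * t) with hF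
  have hFd : ContDiff ℝ 1 F := by fun_prop
  have hFc : HasCompactSupport F := hcf.comp_homeomorph (Homeomorph.mulLeft₀ P hP0.ne')
  have hIF : ∫ s, |F s| = P⁻¹ * ∫ t, |f t| := by
    rw [hF, Measure.integral_comp_mul_left (fun t => |f t|) P, abs_of_pos (by positivity),
      smul_eq_mul]
  have hIF' : ∫ s, |deriv F s| = ∫ t, |deriv f t| := by
    have h1 : ∀ s, |deriv F s| = P * |deriv f (P * s)| := by
      intro s
      rw [hF, deriv_comp_mul_left, smul_eq_mul, abs_mul, abs_of_pos hP0]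
    simp only [h1]
    rw [integral_const_mul, Measure.integral_comp_mul_left (fun t => |deriv f t|) P,
      abs_of_pos (by positivity), smul_eq_mul, mul_inv_cancel_left₀ hP0.ne']
  set J := ∫ t, f t * expDensity δ (t / P) with hJ
  have hJF : ∫ t, F t * expDensity δ t = P⁻¹ * J := by
    have := Measure.integral_comp_mul_left (fun t => f t * expDensity δ (t / P)) P
    simp only [mul_div_cancel_left₀ _ hP0.ne'] at this
    rw [hF, this, abs_of_pos (by positivity), smul_eq_mul]
  have hkey := abs_sum_sum_sub_integral_expDensity_le S (fun x => ω x / Φ)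
    (fun x => (N : ℝ) - x) (fun x hx => div_nonneg (hωS x hx) hΦ.le) hδ hN0 htail hFd hFc
  rw [hsumW, hIF, hIF', hJF, ← hT] at hkey
  set X := ∑ i ∈ S, ∑ j ∈ S, ω i / Φ * (ω j / Φ) * F ((N : ℝ) - i - ((N : ℝ) - j)) with hX
  have hratio : renormalisedPairCorrelation E hE hE0 ω ψ f N = P * X / g ^ 2 := by
    have hXΦ : Φ ^ 2 * X = ∑ x ∈ S, ∑ y ∈ S, ω x * ω y * f (P * (y - x)) := by
      rw [hX, Finset.mul_sum]
      refine Finset.sum_congr rfl fun x _ => ?_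
      rw [Finset.mul_sum]
      refine Finset.sum_congr rfl fun y _ => ?_
      rw [hF]
      simp only [sub_sub_sub_cancel_left]
      field_simp
    rw [renormalisedPairCorrelation, integral_pairCorrelationMeasure _ _ _ hωS, ← hXΦ,
      renormalisingFunction, hgdef, ← hG, ← hP]
    have : G ≠ 0 := by
      intro h; rw [hgdef, h, zero_div] at hg; norm_num at hg
    field_simp
  have hbf := integral_abs_le (by linarith : 0 ≤ A) hf.continuous hs
  have hbf' := integral_abs_le (by linarith : 0 ≤ A) (hf.continuous_deriv le_rfl)
    (tsupport_deriv_subset_Icc hs)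
  have hbJ : |J| ≤ δ * (A * supNorm f) := by
    have := abs_integral_mul_le (g := fun t => expDensity δ (t / P)) (M := δ / 2)
      (by linarith : 0 ≤ A) hf.continuous hs (fun t _ => by
        rw [expDensity, abs_of_nonneg (by positivity)]
        exact mul_le_of_le_one_right (by positivity)
          (Real.exp_le_one_iff.2 (by nlinarith [abs_nonneg (t / P)])))
    linarith
  have hf0 : 0 ≤ A * supNorm f := mul_nonneg (by linarith) (supNorm_nonneg f)
  have hf0' : 0 ≤ A * supNorm (deriv f) := mul_nonneg (by linarith) (supNorm_nonneg _)
  set a := A * supNorm f with ha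
  set a' := A * supNorm (deriv f) with ha'
  have hpl : 0 ≤ powLip α / N := div_nonneg (powLip_nonneg α) hN0.le
  set p := powLip α / N with hp
  have hPB : P * |X - P⁻¹ * J| ≤
      ((K + T) * (P * e * (2 * a')) + (2 * p + δ * e) * (2 * a)) * (g + 1) := by
    refine (mul_le_mul_of_nonneg_left hkey hP0.le).trans ?_
    rw [← mul_assoc]
    refine mul_le_mul_of_nonneg_right ?_ (by linarith)
    have t1 : P * ((K * e + T * Real.exp (-δ * (N / 2))) * ∫ t, |deriv f t|) ≤
        (K + T) * (P * e * (2 * a')) := by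
      have : (K * e + T * Real.exp (-δ * (N / 2))) * (∫ t, |deriv f t|) ≤
          ((K + T) * e) * (2 * a') :=
        mul_le_mul (by linarith [mul_le_mul_of_nonneg_left hδe hT0.le]) (by linarith)
          (integral_nonneg fun _ => abs_nonneg _) (by positivity)
      calc _ ≤ P * (((K + T) * e) * (2 * a')) := mul_le_mul_of_nonneg_left this hP0.le
        _ = _ := by ring
    have t2 : P * ((2 * powLip α / N + δ * Real.exp (-δ * (N / 2))) *
        (P⁻¹ * ∫ t, |f t|)) ≤ (2 * p + δ * e) * (2 * a) := by
      have h2p : 2 * powLip α / N = 2 * p := by rw [hp]; ring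
      rw [h2p]
      calc _ = (2 * p + δ * Real.exp (-δ * (N / 2))) * ∫ t, |f t| := by field_simp
        _ ≤ _ := mul_le_mul (by linarith [mul_le_mul_of_nonneg_left hδe hδ.le]) (by linarith)
          (integral_nonneg fun _ => abs_nonneg _) (by positivity)
    calc _ = P * ((K * e + T * Real.exp (-δ * (N / 2))) * ∫ t, |deriv f t|) +
          P * ((2 * powLip α / N + δ * Real.exp (-δ * (N / 2))) * (P⁻¹ * ∫ t, |f t|)) := by ring
      _ ≤ _ := add_le_add t1 t2
  rw [hratio]
  refine (abs_mul_div_sq_sub_le hP0 hg hg1 hPB hbJ).trans ?_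
  have hq : 0 ≤ P * e * a' := by positivity
  have hpa : 0 ≤ p * a := mul_nonneg hpl hf0
  have hea : 0 ≤ e * a := by positivity
  have k1 : 0 ≤ 2 * (K + T) := by positivity
  have k2 : 0 ≤ 2 * δ + K * δ := by positivity
  calc _ = 4 * ((2 * (K + T) * (P * e * a') + 4 * (p * a) + (2 * δ + K * δ) * (e * a)) *
        (g + 1)) := by ring
    _ ≤ 4 * (((2 * (K + T) + 4 + 2 * δ + K * δ) * (P * e * a' + (p + e) * a)) * (K + 2)) := by
        refine mul_le_mul_of_nonneg_left ?_ (by norm_num)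
        refine mul_le_mul ?_ (by linarith) (by linarith) (by positivity)
        have e1 := mul_nonneg k1 hpa
        have e2 := mul_nonneg k1 hea
        have e3 := mul_nonneg k2 hpa
        have e4 := mul_nonneg k2 hq
        linarith
    _ = _ := by ring

/-- The Laplace density at scale `P` is flat up to `O(A / P)` on the support of `f`. -/
theorem abs_integral_expDensity_div_sub_le {δ P A : ℝ} (hδ : 0 < δ) (hP : 0 < P) (hA : 0 ≤ A)
    {f : ℝ → ℝ} (hf : Continuous f) (hs : tsupport f ⊆ Icc (-A) A) :
    |(∫ t, f t * expDensity δ (t / P)) - δ / 2 * ∫ t, f t| ≤ δ ^ 2 * (A ^ 2 * supNorm f / P) := by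
  have hcf : HasCompactSupport f := isCompact_Icc.of_isClosed_subset (isClosed_tsupport f) hs
  have hexp : Continuous fun t => expDensity δ (t / P) := by unfold expDensity; fun_prop
  have i1 : Integrable fun t => f t * expDensity δ (t / P) :=
    (hf.mul hexp).integrable_of_hasCompactSupport hcf.mul_right
  have i2 : Integrable fun t => f t * (δ / 2) :=
    (hf.integrable_of_hasCompactSupport hcf).mul_const _
  rw [mul_comm (δ / 2), ← integral_mul_const, ← integral_sub i1 i2]
  simp only [← mul_sub]
  refine (abs_integral_mul_le (M := δ / 2 * (δ * A / P)) hA hf hs fun t ht => ?_).trans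
    (le_of_eq (by ring))
  have h1 : |t / P| ≤ A / P := by
    rw [abs_div, abs_of_pos hP]
    exact div_le_div_of_nonneg_right (abs_le.2 ht) hP.le
  have h2 : Real.exp (-δ * |t / P|) ≤ 1 :=
    Real.exp_le_one_iff.2 (by nlinarith [abs_nonneg (t / P)])
  have h3 := Real.add_one_le_exp (-δ * |t / P|)
  have h4 : δ * |t / P| ≤ δ * A / P := by
    rw [mul_div_assoc]; exact mul_le_mul_of_nonneg_left h1 hδ.le
  have : expDensity δ (t / P) - δ / 2 = δ / 2 * (Real.exp (-δ * |t / P|) - 1) := by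
    unfold expDensity; ring
  rw [this, abs_mul, abs_of_pos (half_pos hδ), abs_sub_comm, abs_of_nonneg (by linarith)]
  exact mul_le_mul_of_nonneg_left (by linarith) (half_pos hδ).le

theorem tendsto_rpow_mul_exp_neg_nat (γ : ℝ) {b : ℝ} (hb : 0 < b) :
    Tendsto (fun N : ℕ => (N : ℝ) ^ γ * Real.exp (-b * N)) atTop (𝓝 0) :=
  (tendsto_rpow_mul_exp_neg_mul_atTop_nhds_zero γ b hb).comp tendsto_natCast_atTop_atTop

/-- An at most polynomially growing sequence is subexponentially growing. -/
theorem AtMostPolynomiallyGrowing.subexponentiallyGrowing {u : ℕ → ℝ}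
    (hu : AtMostPolynomiallyGrowing u) : SubexponentiallyGrowing u := by
  obtain ⟨β, -, h⟩ := hu
  intro γ hγ
  have := h.mul (tendsto_rpow_mul_exp_neg_nat β hγ)
  rw [zero_mul] at this
  refine this.congr' ?_
  filter_upwards [eventually_ge_atTop 1] with N hN
  have hN0 : (0 : ℝ) < N := by exact_mod_cast hN
  have : (N : ℝ) ^ β ≠ 0 := (Real.rpow_pos_of_pos hN0 _).ne'
  rw [neg_mul, Real.exp_neg]
  field_simp

theorem SubexponentiallyGrowing.eventually_sq_mul_exp_le {u : ℕ → ℝ}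
    (hu : SubexponentiallyGrowing u) {b : ℝ} (hb : 0 < b) :
    ∀ᶠ N : ℕ in atTop, u N ^ 2 * Real.exp (-b * N) ≤ 1 := by
  have h := (hu (b / 2) (half_pos hb)).pow 2
  filter_upwards [h.eventually (ge_mem_nhds (by norm_num : (0 : ℝ) ^ 2 < 1))] with N hN
  refine le_trans (le_of_eq ?_) hN
  rw [div_pow, ← Real.exp_nat_mul, div_eq_mul_inv, ← Real.exp_neg]
  congr 2
  push_cast
  ring

end PairCorrelation

end

/-! ### The four regimes -/

theorem theorem3p1
    (E : Set ℝ) (hE0 : E ⊆ Ici 0) (hE : IsLocallyFiniteSet E)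
    (ω : ℝ → ℝ) (hω : ∀ x ∈ E, 0 < ω x)
    (α c δ κ : ℝ) (hc : 0 < c) (hδ : 0 < δ) (hκ : 0 < κ)
    (hgrowth : ∃ r : ℝ → ℝ,
      r =O[atTop] (fun t : ℝ => Real.exp (-κ * t)) ∧
      ∀ᶠ t : ℝ in atTop,
        growthFunction E hE hE0 ω t = c * t ^ α * Real.exp (δ * t) * (1 + r t)) :
    ∃ C : ℝ, 0 < C ∧
      ∀ ψ : ℕ → ℝ, (∀ N, 1 ≤ ψ N) →
      ∀ A : ℝ, 1 ≤ A →
      ∀ f : ℝ → ℝ, ContDiff ℝ 1 f → tsupport f ⊆ Icc (-A) A →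
        ((α = 0 → (∀ N, ψ N = 1) →
          ∀ᶠ N : ℕ in atTop,
            |renormalisedPairCorrelation E hE hE0 ω ψ f N - ∫ t, f t * expDensity δ t| ≤
              C * (A * Real.exp (δ * A) * Real.exp (-(min κ δ / 12) * N) * supNorm f) +
              C * (A * Real.exp (-(min κ δ / 4) * N) * supNorm (deriv f))) ∧
        (α ≠ 0 → (∀ N, ψ N = 1) →
          ∀ᶠ N : ℕ in atTop,
            |renormalisedPairCorrelation E hE hE0 ω ψ f N - ∫ t, f t * expDensity δ t| ≤
              C * (A ^ 2 / N * (supNorm f + supNorm (deriv f)))) ∧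
        (α = 0 → Tendsto ψ atTop atTop → SubexponentiallyGrowing ψ →
          ∀ᶠ N : ℕ in atTop,
            |renormalisedPairCorrelation E hE hE0 ω ψ f N - δ / 2 * ∫ t, f t| ≤
              C * (A ^ 2 * supNorm f / ψ N) +
              C * (A ^ 2 * Real.exp (-(min κ δ / 4) * N) * ψ N * supNorm (deriv f))) ∧
        (α ≠ 0 → Tendsto ψ atTop atTop → AtMostPolynomiallyGrowing ψ →
          ∀ᶠ N : ℕ in atTop,
            |renormalisedPairCorrelation E hE hE0 ω ψ f N - δ / 2 * ∫ t, f t| ≤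
              C * (A ^ 2 / min (N : ℝ) (ψ N) * (supNorm f + supNorm (deriv f))))) := by
  obtain ⟨C₀, hC₀, hmain⟩ :=
    exists_abs_renormalisedPairCorrelation_sub_le hE0 hE hω hc hδ hκ hgrowth
  have hm : 0 < min κ δ := lt_min hκ hδ
  set m := min κ δ
  have hp := powLip_nonneg α
  set p := powLip α with hpdef
  refine ⟨C₀ * (p + 1) + δ ^ 2, by positivity, fun ψ hψ A hA f hf hs => ?_⟩
  replace hmain := hmain.mono fun N h => h ψ (hψ N) A hA f hf hs
  have hf0 := supNorm_nonneg f
  have hf0' := supNorm_nonneg (deriv f)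
  set a := supNorm f
  set a' := supNorm (deriv f)
  have hAA : A ≤ A ^ 2 := by nlinarith
  have hA0 : 0 < A := by linarith
  have hCle : C₀ ≤ C₀ * (p + 1) + δ ^ 2 := by nlinarith [mul_nonneg hC₀.le hp, sq_nonneg δ]
  have hCle' : C₀ * (p + 1) ≤ C₀ * (p + 1) + δ ^ 2 := by linarith [sq_nonneg δ]
  have hexp : ∀ (q : ℝ) (N : ℕ), q ≤ m / 2 →
      Real.exp (-(m / 2) * N) ≤ Real.exp (-q * N) := fun q N hq =>
    Real.exp_le_exp.2 (by nlinarith [(Nat.cast_nonneg N : (0 : ℝ) ≤ N)])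
  refine ⟨fun hα hψ1 => ?_, fun _ hψ1 => ?_, fun hα _ hsub => ?_, fun _ _ hpoly => ?_⟩
  -- for `α = 0` the error term of order `1 / N` disappears together with `p`
  · have hp0 : p = 0 := by rw [hpdef, hα, powLip_zero]
    filter_upwards [hmain] with N hN
    simp only [hψ1, div_one, one_mul, hp0, zero_div, zero_add] at hN ⊢
    have h4 := hexp (m / 4) N (by linarith)
    have h12 := hexp (m / 12) N (by linarith)
    have hδA : 1 ≤ Real.exp (δ * A) := Real.one_le_exp (by positivity)
    rw [hp0, zero_add] at hCle
    calc _ ≤ C₀ * (Real.exp (-(m / 2) * N) * (A * a') + Real.exp (-(m / 2) * N) * (A * a)) := hN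
      _ ≤ C₀ * (Real.exp (-(m / 4) * N) * (A * a') +
          1 * Real.exp (-(m / 12) * N) * (A * a)) := by rw [one_mul]; gcongr
      _ ≤ (C₀ * 1 + δ ^ 2) * (Real.exp (-(m / 4) * N) * (A * a') +
          Real.exp (δ * A) * Real.exp (-(m / 12) * N) * (A * a)) := by gcongr
      _ = _ := by ring
  · filter_upwards [hmain, eventually_ge_atTop 1,
      (tendsto_rpow_mul_exp_neg_nat 1 (half_pos hm)).eventually
        (ge_mem_nhds zero_lt_one)] with N hN hN1 he
    have hN0 : (0 : ℝ) < N := by exact_mod_cast hN1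
    rw [Real.rpow_one, mul_comm, ← le_div_iff₀ hN0] at he
    simp only [hψ1, div_one, one_mul] at hN ⊢
    calc _ ≤ C₀ * (Real.exp (-(m / 2) * N) * (A * a') +
          (p / N + Real.exp (-(m / 2) * N)) * (A * a)) := hN
      _ ≤ C₀ * ((p + 1) * (1 / N) * (A ^ 2 * a') + (p / N + 1 / N) * (A ^ 2 * a)) := by
          gcongr
          calc _ ≤ 1 * (1 / (N : ℝ)) := by rw [one_mul]; exact he
            _ ≤ _ := by gcongr; linarith
      _ = C₀ * (p + 1) * (A ^ 2 / N * (a + a')) := by ring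
      _ ≤ _ := by gcongr
  · have hp0 : p = 0 := by rw [hpdef, hα, powLip_zero]
    filter_upwards [hmain, hsub.eventually_sq_mul_exp_le (half_pos hm)] with N hN he
    have hP := hψ N
    have hP0 : 0 < ψ N := by linarith
    have h4 := hexp (m / 4) N (by linarith)
    -- the growth bound on `ψ` lets the exponential absorb the factor `ψ N` twice
    have he' : Real.exp (-(m / 2) * N) ≤ 1 / ψ N := by
      rw [le_div_iff₀ hP0]
      nlinarith [Real.exp_pos (-(m / 2) * N)]
    have hflat := abs_integral_expDensity_div_sub_le hδ hP0 hA0.le hf.continuous hs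
    simp only [hp0, zero_div, zero_add, mul_one] at hN ⊢
    calc _ ≤ C₀ * (ψ N * Real.exp (-(m / 2) * N) * (A * a') +
          Real.exp (-(m / 2) * N) * (A * a)) + δ ^ 2 * (A ^ 2 * a / ψ N) :=
          (abs_sub_le _ _ _).trans (add_le_add hN hflat)
      _ ≤ C₀ * (ψ N * Real.exp (-(m / 4) * N) * (A ^ 2 * a') +
          1 / ψ N * (A ^ 2 * a)) + δ ^ 2 * (A ^ 2 * a / ψ N) := by gcongr
      _ = (C₀ + δ ^ 2) * (A ^ 2 * a / ψ N) +
          C₀ * (A ^ 2 * Real.exp (-(m / 4) * N) * ψ N * a') := by ring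
      _ ≤ _ := by
          gcongr
          linarith [sq_nonneg δ]
  · filter_upwards [hmain, eventually_ge_atTop 1,
      hpoly.subexponentiallyGrowing.eventually_sq_mul_exp_le (half_pos hm)] with N hN hN1 he
    have hN0 : (0 : ℝ) < N := by exact_mod_cast hN1
    have hP := hψ N
    have hP0 : 0 < ψ N := by linarith
    have hM : 0 < min (N : ℝ) (ψ N) := lt_min hN0 hP0
    have hMN : 1 / (N : ℝ) ≤ 1 / min (N : ℝ) (ψ N) :=
      one_div_le_one_div_of_le hM (min_le_left _ _)
    have hMP : 1 / ψ N ≤ 1 / min (N : ℝ) (ψ N) :=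
      one_div_le_one_div_of_le hM (min_le_right _ _)
    have hflat := abs_integral_expDensity_div_sub_le hδ hP0 hA0.le hf.continuous hs
    set M := min (N : ℝ) (ψ N)
    have he1 : ψ N * Real.exp (-(m / 2) * N) ≤ 1 / M := by
      refine le_trans ?_ hMP
      rw [le_div_iff₀ hP0]
      linarith
    have he2 : Real.exp (-(m / 2) * N) ≤ 1 / M := by
      nlinarith [Real.exp_pos (-(m / 2) * N)]
    have hpN : p / N ≤ p * (1 / M) := by
      rw [div_eq_mul_one_div]; gcongr
    set q := ψ N * Real.exp (-(m / 2) * N)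
    calc _ ≤ C₀ * (q * (A * a') +
          (p / N + Real.exp (-(m / 2) * N)) * (A * a)) + δ ^ 2 * (A ^ 2 * a / ψ N) :=
          (abs_sub_le _ _ _).trans (add_le_add hN hflat)
      _ ≤ C₀ * ((p + 1) * (1 / M) * (A ^ 2 * a') + (p * (1 / M) + 1 / M) * (A ^ 2 * a)) +
          δ ^ 2 * (A ^ 2 * (a + a') * (1 / M)) := by
          have : A ^ 2 * a / ψ N ≤ A ^ 2 * (a + a') * (1 / M) := by
            rw [div_eq_mul_one_div]
            gcongr
            linarith
          gcongr
          calc _ ≤ 1 * (1 / M) := by rw [one_mul]; exact he1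
            _ ≤ _ := by gcongr; linarith
      _ = _ := by ring
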